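/- For integers $n\ge 1$ and $k\ge 0$ let $c_{n,k}$ be the number of simple connected graphs with $k$ edges on $n$ labelled vertices, and let $$\overline{C}_n(y)=\sum_{k=n-1}^{n(n-1)/2}c_{n,k}\,(y-1)^k .$$ For a complex polynomial $p$ of degree $d\ge 1$, the empirical measure of $p$ is the probability measure on $\mathbf{C}$ that has an atom of mass $m/d$ at every zero of $p$ of multiplicity $m$. For every $n\ge 2$ the polynomial $\overline{C}_n$ is monic of degree $n(n-1)/2\ge 1$, so that its empirical measure $\mu_n$ is a well-defined probability measure. As $n\to\infty$, the measures $\mu_n$ converge weakly to the uniform probability measure on the unit circle: for every bounded continuous function $f:\mathbf{C}\to\mathbf{R}$, $$\int f\,d\mu_n\ \longrightarrow\ \frac1{2\pi}\int_0^{2\pi}f(e^{i\theta})\,d\theta .$$ -/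

import Mathlib

open Filter Topology MeasureTheory Polynomial
open scoped NNReal ENNReal

noncomputable section

/-- The number of connected simple graphs with `k` edges on `n` labelled vertices. -/
def numConnectedGraphs (n k : ℕ) : ℕ :=
  Nat.card {G : SimpleGraph (Fin n) // G.Connected ∧ G.edgeSet.ncard = k}

/-- The polynomial `∑ c_{n,k} (y - 1) ^ k`, where `k` runs from `n - 1` to `n (n - 1) / 2`. -/
def connectedGraphPoly (n : ℕ) : ℂ[X] :=
  ∑ k ∈ Finset.Icc (n - 1) (n * (n - 1) / 2), C (numConnectedGraphs n k : ℂ) * (X - 1) ^ k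

/-- The empirical measure of the zeros of a polynomial `p` of positive degree `d`: every zero of
multiplicity `m` carries an atom of mass `m / d`. (It is `0` when `p` is constant.) -/
def empiricalMeasure (p : ℂ[X]) : FiniteMeasure ℂ :=
  (p.natDegree : ℝ≥0)⁻¹ • (p.roots.map fun z => (diracProba z).toFiniteMeasure).sum

/-- The uniform distribution on the unit circle: the law of `exp (i θ)` for `θ` uniform on
`(0, 2π]`. -/
def uniformUnitCircle : ProbabilityMeasure ℂ :=
  ⟨(ENNReal.ofReal (2 * Real.pi))⁻¹ •
      (volume.restrict (Set.Ioc 0 (2 * Real.pi))).map (fun θ : ℝ => Complex.exp (θ * Complex.I)), by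
    have hm : Measurable fun θ : ℝ => Complex.exp (θ * Complex.I) := by fun_prop
    constructor
    rw [Measure.smul_apply, Measure.map_apply hm MeasurableSet.univ, Set.preimage_univ,
      Measure.restrict_apply_univ, Real.volume_Ioc, sub_zero, smul_eq_mul]
    exact ENNReal.inv_mul_cancel (by simp [Real.pi_pos]) ENNReal.ofReal_ne_top⟩

end

/-! This is an Erdős–Turán argument. A monic polynomial whose value at `0` has modulus at least `1`,
and whose maximum on the unit circle is `exp (o(degree))`, has zeros that equidistribute on that
circle (`tendsto_empiricalMeasure_uniformUnitCircle`).

Both inputs come from a recurrence. With `y = t + 1`, all graphs on `m` vertices have generating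
function `y ^ (m.choose 2)`, and sorting them by the component of one vertex expresses this through
the connected ones (`sum_connectedSum_mul`). At `y = 0` the recurrence gives a signed factorial
(`connectedSum_neg_one`). On the closed unit disc it gives the bound `n ^ n`
(`norm_connectedSum_le`), whose logarithm `n log n` is negligible against the quadratic degree.

For the zeros, the maximum principle bounds the Mahler measure, so `|log ‖z‖|` is small on average
(`Complex.sum_abs_log_norm_le`). Reflecting the zeros across the circle makes a logarithm available
on the disc. Borel–Carathéodory and Cauchy estimates then bound the power sums of the directions
(`Complex.norm_sum_direction_pow_le`), and Weyl's criterion concludes. -/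

/-! ### Generating function of connected graphs: recurrence and bounds -/

namespace SimpleGraph

open scoped Classical in
/-- The generating function `∑ t ^ |E(G)|` of the connected graphs `G` on the vertex set `V`. -/
noncomputable def connectedSum (V : Type*) [Fintype V] (t : ℂ) : ℂ :=
  ∑ G : SimpleGraph V with G.Connected, t ^ G.edgeSet.ncard

lemma Iso.ncard_edgeSet_eq {V W : Type*} {G : SimpleGraph V} {H : SimpleGraph W} (e : G ≃g H) :
    G.edgeSet.ncard = H.edgeSet.ncard :=
  Nat.card_congr e.mapEdgeSet

lemma ncard_edgeSet_sum {V W : Type*} [Finite V] [Finite W] (G : SimpleGraph V)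
    (H : SimpleGraph W) : (G ⊕g H).edgeSet.ncard = G.edgeSet.ncard + H.edgeSet.ncard := by
  have := Nat.card_congr (edgeSetSumEquiv (G := G) (H := H))
  rwa [Nat.card_sum] at this

lemma ncard_edgeSet_le {V : Type*} [Fintype V] (G : SimpleGraph V) :
    G.edgeSet.ncard ≤ (Fintype.card V).choose 2 := by
  classical
  rw [← coe_edgeFinset, Set.ncard_coe_finset]
  exact card_edgeFinset_le_card_choose_two

lemma ncard_edgeSet_top (V : Type*) [Fintype V] :
    (⊤ : SimpleGraph V).edgeSet.ncard = (Fintype.card V).choose 2 := by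
  classical
  rw [← coe_edgeFinset, Set.ncard_coe_finset]
  exact card_edgeFinset_top_eq_card_choose_two

lemma connectedSum_congr {V W : Type*} [Fintype V] [Fintype W] (e : V ≃ W) (t : ℂ) :
    connectedSum V t = connectedSum W t := by
  classical
  refine Finset.sum_equiv e.simpleGraph (fun G => ?_) (fun G _ => ?_)
  · simpa using (Iso.comap e.symm G).connected_iff.symm
  · rw [(Iso.comap e.symm G).ncard_edgeSet_eq.symm, Equiv.simpleGraph_apply]

lemma connectedSum_eq_fin (V : Type*) [Fintype V] (t : ℂ) :
    connectedSum V t = connectedSum (Fin (Nat.card V)) t :=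
  connectedSum_congr (Finite.equivFin V) t

/-- Graphs are the subsets of the edge set of the complete graph, so this is the binomial theorem.
-/
lemma sum_pow_ncard_edgeSet (V : Type*) [Finite V] [Fintype (SimpleGraph V)] (t : ℂ) :
    ∑ G : SimpleGraph V, t ^ G.edgeSet.ncard = (t + 1) ^ (Nat.card V).choose 2 := by
  classical
  have := Fintype.ofFinite V
  rw [Nat.card_eq_fintype_card, ← card_edgeFinset_top_eq_card_choose_two, ← Finset.sum_pow_mul_eq_add_pow]
  simp only [one_pow, mul_one]
  refine Finset.sum_bij' (fun G _ => G.edgeFinset) (fun s _ => fromEdgeSet (s : Set (Sym2 V)))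
    ?_ ?_ ?_ ?_ ?_
  · intro G _
    simp only [Finset.mem_powerset]
    exact edgeFinset_mono le_top
  · simp
  · intro G _
    simp
  · intro s hs
    ext e
    have : e ∈ s → e ∈ (⊤ : SimpleGraph V).edgeFinset := fun h => Finset.mem_powerset.1 hs (show e ∈ s from h)
    simp only [mem_edgeFinset, edgeSet_fromEdgeSet, Set.mem_sdiff, Finset.mem_coe] at this ⊢
    refine ⟨fun h => h.1, fun h => ⟨h, ?_⟩⟩
    simpa using this h
  · intro G _
    rw [← Set.ncard_coe_finset, coe_edgeFinset]

lemma reachable_mem_of_forall_adj {V : Type*} {G : SimpleGraph V} {S : Set V}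
    (hS : ∀ a b, G.Adj a b → a ∈ S → b ∈ S) {v w : V} (hv : v ∈ S) (h : G.Reachable v w) :
    w ∈ S := by
  obtain ⟨p⟩ := h
  induction p with
  | nil => exact hv
  | cons hadj _ ih => exact ih (hS _ _ hadj hv)

-- When `S` is the component of `v`, no edge joins `S` to its complement: the graph is the disjoint
-- sum of a connected graph on `S` and an arbitrary graph on `Sᶜ`.
open scoped Classical in
lemma sum_reachable_eq {V : Type*} [Fintype V] (v : V) (S : Set V) (hv : v ∈ S) (t : ℂ) :
    ∑ G : SimpleGraph V with {w | G.Reachable v w} = S, t ^ G.edgeSet.ncard =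
      connectedSum S t * ∑ G : SimpleGraph ↥Sᶜ, t ^ G.edgeSet.ncard := by
  let e := Equiv.Set.sumCompl S
  rw [connectedSum, Finset.sum_mul_sum, ← Finset.sum_product']
  symm
  refine Finset.sum_bij' (fun P _ => e.simpleGraph (P.1 ⊕g P.2))
    (fun G _ => (G.induce S, G.induce Sᶜ)) ?_ ?_ ?_ ?_ ?_
  · rintro ⟨H, K⟩ hP
    simp only [Finset.mem_product, Finset.mem_filter, Finset.mem_univ, true_and, and_true] at hP ⊢
    refine Set.Subset.antisymm (fun w hw => ?_) (fun w hw => ?_)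
    · refine reachable_mem_of_forall_adj (fun a b hab ha => ?_) hv hw
      by_contra hb
      simp [e, Equiv.Set.sumCompl_symm_apply_of_mem ha,
        Equiv.Set.sumCompl_symm_apply_of_notMem hb] at hab
    · have h := ((hP.preconnected ⟨v, hv⟩ ⟨w, hw⟩).map
        (Embedding.sumInl (G := H) (H := K)).toHom).map (Iso.comap e.symm (H ⊕g K)).symm.toHom
      simpa [e] using h
  · intro G hG
    simp only [Finset.mem_product, Finset.mem_filter, Finset.mem_univ, true_and, and_true] at hG ⊢
    have : S = (G.connectedComponentMk v).supp := by
      rw [← hG]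
      ext w
      simp [reachable_comm]
    rw [this]
    exact (G.connectedComponentMk v).connected_toSimpleGraph
  · rintro ⟨H, K⟩ _
    ext a b <;> simp [e]
  · intro G hG
    simp only [Finset.mem_filter, Finset.mem_univ, true_and] at hG
    have hadj : ∀ a b, G.Adj a b → a ∈ S → b ∈ S := by
      intro a b hab ha
      rw [← hG] at ha ⊢
      exact Reachable.trans ha hab.reachable
    ext a b
    by_cases ha : a ∈ S <;> by_cases hb : b ∈ S
    · simp [e, Equiv.Set.sumCompl_symm_apply_of_mem ha, Equiv.Set.sumCompl_symm_apply_of_mem hb]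
    · have : ¬ G.Adj a b := fun h => hb (hadj _ _ h ha)
      simp [e, Equiv.Set.sumCompl_symm_apply_of_mem ha,
        Equiv.Set.sumCompl_symm_apply_of_notMem hb, this]
    · have : ¬ G.Adj a b := fun h => ha (hadj _ _ h.symm hb)
      simp [e, Equiv.Set.sumCompl_symm_apply_of_notMem ha,
        Equiv.Set.sumCompl_symm_apply_of_mem hb, this]
    · simp [e, Equiv.Set.sumCompl_symm_apply_of_notMem ha,
        Equiv.Set.sumCompl_symm_apply_of_notMem hb]
  · rintro ⟨H, K⟩ _
    rw [← pow_add, ← ncard_edgeSet_sum]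
    exact congrArg (t ^ ·) (Iso.comap e.symm (H ⊕g K)).ncard_edgeSet_eq.symm

/-- Sorting the graphs on `V` by the component of a fixed vertex. -/
lemma sum_connectedSum_mul {V : Type*} [Fintype V] (v : V) {n : ℕ} (hV : Fintype.card V = n + 1)
    (t : ℂ) :
    (t + 1) ^ (n + 1).choose 2 = ∑ k ∈ Finset.range (n + 1),
      (n.choose k : ℂ) * (connectedSum (Fin (k + 1)) t * (t + 1) ^ (n - k).choose 2) := by
  classical
  have h1 := sum_pow_ncard_edgeSet V t
  rw [Nat.card_eq_fintype_card, hV] at h1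
  rw [← h1, ← Finset.sum_fiberwise Finset.univ
    (fun G : SimpleGraph V => ({w | G.Reachable v w} : Finset V))]
  have h2 : ∀ S : Finset V,
      (∑ G : SimpleGraph V with ({w | G.Reachable v w} : Finset V) = S,
        t ^ G.edgeSet.ncard) = if v ∈ S then
          connectedSum (Fin S.card) t * (t + 1) ^ (n + 1 - S.card).choose 2 else 0 := by
    intro S
    split_ifs with hv
    · have h3 := sum_reachable_eq v (S : Set V) (by simpa using hv) t
      have h4 : Nat.card ↥(S : Set V) = S.card := by simp
      have h5 : Nat.card ↥(S : Set V)ᶜ = n + 1 - S.card := by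
        rw [← Finset.coe_compl, ← hV, ← Finset.card_compl]
        exact Nat.card_eq_card_toFinset _ |>.trans (by rw [Finset.toFinset_coe])
      rw [sum_pow_ncard_edgeSet, connectedSum_eq_fin, h4, h5] at h3
      refine Eq.trans ?_ h3
      refine Finset.sum_congr (Finset.filter_congr fun G _ => ?_) fun _ _ => rfl
      rw [← Finset.coe_inj]
      simp
    · refine Finset.sum_eq_zero fun G hG => ?_
      simp only [Finset.mem_filter, Finset.mem_univ, true_and] at hG
      refine absurd ?_ hv
      rw [← hG]
      simp
  rw [Finset.sum_congr rfl fun S _ => h2 S, ← Finset.sum_filter]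
  have hcard : (Finset.univ.erase v).card = n := by
    rw [Finset.card_erase_of_mem (Finset.mem_univ v), Finset.card_univ, hV, Nat.add_sub_cancel]
  have h5 := Finset.sum_powerset_apply_card
    (fun k => connectedSum (Fin (k + 1)) t * (t + 1) ^ (n - k).choose 2)
    (x := Finset.univ.erase v)
  rw [hcard] at h5
  simp only [nsmul_eq_mul] at h5
  rw [← h5]
  -- The component is determined by its `k` vertices other than `v`, chosen among the remaining `n`.
  refine Finset.sum_bij' (fun S _ => S.erase v) (fun T _ => insert v T) ?_ ?_ ?_ ?_ ?_
  · intro S _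
    simpa using Finset.erase_subset_erase v (Finset.subset_univ S)
  · simp
  · intro S hS
    exact Finset.insert_erase (by simpa using hS)
  · intro T hT
    refine Finset.erase_insert fun h => ?_
    simpa using Finset.mem_powerset.1 hT h
  · intro S hS
    have hS' : v ∈ S := by simpa using hS
    have := Finset.card_erase_add_one hS'
    have h6 : n + 1 - S.card = n - (S.erase v).card := by omega
    rw [h6, this]

lemma connectedSum_succ (n : ℕ) (t : ℂ) :
    connectedSum (Fin (n + 1)) t = (t + 1) ^ (n + 1).choose 2 - ∑ k ∈ Finset.range n,
      (n.choose k : ℂ) * (connectedSum (Fin (k + 1)) t * (t + 1) ^ (n - k).choose 2) := by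
  rw [sum_connectedSum_mul (0 : Fin (n + 1)) (Fintype.card_fin _), Finset.sum_range_succ]
  simp

/-- Here `t + 1 = 0`, and `(n + 1 - k).choose 2` is positive for `k < n`. Only the term `k = n` of
the recurrence survives, so each step multiplies by `-(n + 1)`. -/
lemma connectedSum_neg_one (n : ℕ) :
    connectedSum (Fin (n + 1)) (-1) = (-1) ^ n * (n.factorial : ℂ) := by
  induction n with
  | zero => rw [connectedSum_succ]; simp
  | succ n ih =>
    have hsum : ∑ k ∈ Finset.range (n + 1), ((n + 1).choose k : ℂ) *
        (connectedSum (Fin (k + 1)) (-1) * (-1 + 1) ^ (n + 1 - k).choose 2) =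
        (n + 1) * connectedSum (Fin (n + 1)) (-1) := by
      rw [Finset.sum_range_succ, Finset.sum_eq_zero]
      · simp
      · intro k hk
        have : (n + 1 - k).choose 2 ≠ 0 :=
          (Nat.choose_pos (by have := Finset.mem_range.1 hk; omega)).ne'
        simp [this]
    have h0 : (n + 1 + 1).choose 2 ≠ 0 := (Nat.choose_pos (by omega)).ne'
    rw [connectedSum_succ, hsum, ih, neg_add_cancel, zero_pow h0, Nat.factorial_succ]
    push_cast
    ring

lemma norm_connectedSum_le (n : ℕ) {t : ℂ} (ht : ‖t + 1‖ ≤ 1) :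
    ‖connectedSum (Fin (n + 1)) t‖ ≤ (n + 1 : ℝ) ^ (n + 1) := by
  induction n using Nat.strong_induction_on with
  | _ n ih =>
  rcases Nat.eq_zero_or_pos n with rfl | hn
  · rw [connectedSum_succ]; simp
  have hn1 : (1 : ℝ) ≤ n := by exact_mod_cast hn
  have hterm : ∀ k ∈ Finset.range n, ‖(n.choose k : ℂ) *
      (connectedSum (Fin (k + 1)) t * (t + 1) ^ (n - k).choose 2)‖ ≤
      n * ((n : ℝ) ^ k * (1 : ℝ) ^ (n - k) * n.choose k) := by
    intro k hk
    have hkn := Finset.mem_range.1 hk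
    rw [norm_mul, norm_mul, norm_pow, Complex.norm_natCast]
    have h1 : ‖t + 1‖ ^ (n - k).choose 2 ≤ 1 := pow_le_one₀ (norm_nonneg _) ht
    -- Replacing the base `k + 1` by `n` turns the sum into `n` times the binomial expansion of `(n
    -- + 1) ^ n` without its top term.
    have h2 : ((k : ℝ) + 1) ^ (k + 1) ≤ (n : ℝ) ^ (k + 1) := by
      gcongr
      exact_mod_cast hkn
    calc (n.choose k : ℝ) * (‖connectedSum (Fin (k + 1)) t‖ * ‖t + 1‖ ^ (n - k).choose 2)
        ≤ n.choose k * ((n : ℝ) ^ (k + 1) * 1) := by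
          gcongr
          exact (ih k hkn).trans h2
      _ = _ := by rw [one_pow]; ring
  have hbin := add_pow (n : ℝ) 1 n
  rw [Finset.sum_range_succ] at hbin
  simp only [Nat.choose_self, Nat.sub_self, pow_zero, Nat.cast_one, mul_one] at hbin
  rw [connectedSum_succ]
  calc _ ≤ ‖(t + 1) ^ (n + 1).choose 2‖ + ‖∑ k ∈ Finset.range n, (n.choose k : ℂ) *
        (connectedSum (Fin (k + 1)) t * (t + 1) ^ (n - k).choose 2)‖ := norm_sub_le _ _
    _ ≤ 1 + ∑ k ∈ Finset.range n, n * ((n : ℝ) ^ k * (1 : ℝ) ^ (n - k) * n.choose k) := by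
        refine add_le_add ?_ (norm_sum_le_of_le _ hterm)
        rw [norm_pow]
        exact pow_le_one₀ (norm_nonneg _) ht
    _ = 1 + n * (((n : ℝ) + 1) ^ n - (n : ℝ) ^ n) := by
        rw [← Finset.mul_sum, hbin]
        simp
    _ ≤ _ := by
        have h3 : (1 : ℝ) ≤ (n : ℝ) ^ (n + 1) := one_le_pow₀ hn1
        have h4 : (0 : ℝ) ≤ ((n : ℝ) + 1) ^ n := by positivity
        rw [pow_succ] at h3 ⊢
        linarith

end SimpleGraph

/-! ### The polynomial: degree, value at the origin, size on the disc -/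

section ConnectedGraphPoly

open SimpleGraph

lemma connectedSum_eq_sum_card (V : Type*) [Fintype V] (t : ℂ) :
    connectedSum V t = ∑ k ∈ Finset.Icc (Fintype.card V - 1) ((Fintype.card V).choose 2),
      (Nat.card {G : SimpleGraph V // G.Connected ∧ G.edgeSet.ncard = k} : ℂ) * t ^ k := by
  classical
  rw [connectedSum]
  refine Eq.trans (Finset.sum_fiberwise_of_maps_to
    (t := Finset.Icc (Fintype.card V - 1) ((Fintype.card V).choose 2))
    (g := fun G : SimpleGraph V => G.edgeSet.ncard) ?_ _).symm ?_
  · intro G hG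
    have h1 := (Finset.mem_filter.1 hG).2.card_vert_le_card_edgeSet_add_one
    rw [Nat.card_eq_fintype_card (α := V)] at h1
    exact Finset.mem_Icc.2 ⟨Nat.sub_le_iff_le_add.2 h1, G.ncard_edgeSet_le⟩
  · refine Finset.sum_congr rfl fun k _ => ?_
    rw [Finset.sum_congr rfl fun G hG => by rw [(Finset.mem_filter.1 hG).2], Finset.sum_const,
      Finset.filter_filter, nsmul_eq_mul, Nat.card_eq_fintype_card, Fintype.card_subtype]

lemma eval_connectedGraphPoly (n : ℕ) (y : ℂ) :
    (connectedGraphPoly n).eval y = connectedSum (Fin n) (y - 1) := by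
  rw [connectedSum_eq_sum_card, connectedGraphPoly, eval_finsetSum, Fintype.card_fin,
    Nat.choose_two_right]
  simp [numConnectedGraphs]

lemma numConnectedGraphs_choose_two {n : ℕ} (hn : 1 ≤ n) :
    numConnectedGraphs n (n * (n - 1) / 2) = 1 := by
  have : NeZero n := ⟨by omega⟩
  rw [numConnectedGraphs, Nat.card_eq_one_iff_exists]
  have htop := ncard_edgeSet_top (Fin n)
  rw [Fintype.card_fin, Nat.choose_two_right] at htop
  refine ⟨⟨⊤, connected_top, htop⟩, ?_⟩
  rintro ⟨G, hG, hcard⟩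
  rw [Subtype.mk.injEq, ← edgeSet_inj]
  exact Set.eq_of_subset_of_ncard_le (edgeSet_mono le_top) (by rw [htop, hcard])

lemma le_mul_pred_div_two {n : ℕ} (hn : 1 ≤ n) : n - 1 ≤ n * (n - 1) / 2 := by
  rw [Nat.le_div_iff_mul_le two_pos, mul_comm]
  rcases Nat.eq_or_lt_of_le hn with rfl | h
  · simp
  · exact Nat.mul_le_mul_right _ h

lemma connectedGraphPoly_eq_add {n : ℕ} (hn : 1 ≤ n) :
    ∃ q : ℂ[X], q.degree < (n * (n - 1) / 2 : ℕ) ∧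
      connectedGraphPoly n = (X - C 1) ^ (n * (n - 1) / 2) + q := by
  refine ⟨∑ k ∈ Finset.Ico (n - 1) (n * (n - 1) / 2),
    C (numConnectedGraphs n k : ℂ) * (X - 1) ^ k, ?_, ?_⟩
  · refine (degree_sum_le _ _).trans_lt ((Finset.sup_lt_iff (WithBot.bot_lt_coe _)).2 ?_)
    intro k hk
    refine ((degree_mul_le _ _).trans (add_le_add degree_C_le le_rfl)).trans_lt ?_
    rw [zero_add, ← C_1, degree_pow, degree_X_sub_C, nsmul_one]
    exact_mod_cast (Finset.mem_Ico.1 hk).2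
  · rw [connectedGraphPoly, ← Finset.Ico_insert_right (le_mul_pred_div_two hn),
      Finset.sum_insert Finset.right_notMem_Ico, numConnectedGraphs_choose_two hn]
    simp

lemma connectedGraphPoly_monic {n : ℕ} (hn : 1 ≤ n) : (connectedGraphPoly n).Monic := by
  obtain ⟨q, hq, h⟩ := connectedGraphPoly_eq_add hn
  rw [h]
  refine ((monic_X_sub_C 1).pow _).add_of_left ?_
  rwa [degree_pow, degree_X_sub_C, nsmul_one]

lemma natDegree_connectedGraphPoly {n : ℕ} (hn : 1 ≤ n) :
    (connectedGraphPoly n).natDegree = n * (n - 1) / 2 := by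
  obtain ⟨q, hq, h⟩ := connectedGraphPoly_eq_add hn
  have hd : ((X - C 1 : ℂ[X]) ^ (n * (n - 1) / 2)).degree = (n * (n - 1) / 2 : ℕ) := by
    rw [degree_pow, degree_X_sub_C, nsmul_one]
  rw [h]
  exact natDegree_eq_of_degree_eq_some ((degree_add_eq_left_of_degree_lt (by rwa [hd])).trans hd)

lemma one_le_norm_eval_zero_connectedGraphPoly {n : ℕ} (hn : 1 ≤ n) :
    1 ≤ ‖(connectedGraphPoly n).eval 0‖ := by
  obtain ⟨m, rfl⟩ := Nat.exists_eq_add_of_le' hn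
  rw [eval_connectedGraphPoly, zero_sub, connectedSum_neg_one]
  simpa using! Nat.one_le_iff_ne_zero.2 (Nat.factorial_ne_zero m)

lemma norm_eval_connectedGraphPoly_le {n : ℕ} (hn : 1 ≤ n) {y : ℂ} (hy : ‖y‖ ≤ 1) :
    ‖(connectedGraphPoly n).eval y‖ ≤ (n : ℝ) ^ n := by
  obtain ⟨m, rfl⟩ := Nat.exists_eq_add_of_le' hn
  rw [eval_connectedGraphPoly]
  exact_mod_cast norm_connectedSum_le m (by simpa using hy)

end ConnectedGraphPoly

/-! ### Zeros of a polynomial and its maximum on the unit circle -/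

namespace Complex

open scoped ComplexConjugate

lemma iteratedDeriv_succ_log_one_sub_mul (a : ℂ) (k : ℕ) {w : ℂ}
    (hw : 1 - a * w ∈ slitPlane) :
    iteratedDeriv (k + 1) (fun w => log (1 - a * w)) w =
      -(k.factorial * a ^ (k + 1)) * ((1 - a * w) ^ (k + 1))⁻¹ := by
  have hlin : ∀ w : ℂ, HasDerivAt (fun w => 1 - a * w) (-a) w := fun w => by
    simpa using ((hasDerivAt_id w).const_mul a).const_sub 1
  induction k generalizing w with
  | zero =>
    rw [zero_add, iteratedDeriv_one, ((hlin w).clog hw).deriv]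
    simp [div_eq_mul_inv]
  | succ k ih =>
    have hopen : ∀ᶠ u in 𝓝 w, 1 - a * u ∈ slitPlane :=
      (hlin w).continuousAt.eventually_mem (isOpen_slitPlane.mem_nhds hw)
    have h0 : 1 - a * w ≠ 0 := slitPlane_ne_zero hw
    have hev : iteratedDeriv (k + 1) (fun w => log (1 - a * w)) =ᶠ[𝓝 w] fun u =>
        -(k.factorial * a ^ (k + 1)) * ((1 - a * u) ^ (k + 1))⁻¹ :=
      hopen.mono fun u hu => ih hu
    have hd := ((((hlin w).pow (k + 1)).inv (pow_ne_zero _ h0)).const_mul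
      (-(k.factorial * a ^ (k + 1))))
    rw [iteratedDeriv_succ, hev.deriv_eq]
    refine hd.deriv.trans ?_
    rw [Nat.factorial_succ]
    simp only [Pi.pow_apply]
    push_cast
    field_simp
    ring

lemma one_sub_mul_mem_slitPlane {a w : ℂ} (ha : ‖a‖ ≤ 1) (hw : ‖w‖ < 1) :
    1 - a * w ∈ slitPlane := by
  rw [sub_eq_add_neg]
  refine mem_slitPlane_of_norm_lt_one ?_
  rw [norm_neg, norm_mul]
  exact (mul_le_of_le_one_left (norm_nonneg _) ha).trans_lt hw

/-- If `∏ (1 - a i * w)` has all its zeros outside of the open unit disc and is bounded by `M`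
there, then the power sums of the `a i` are of order `log M`. -/
lemma norm_sum_pow_le {ι : Type*} [Fintype ι] {a : ι → ℂ} (ha : ∀ i, ‖a i‖ ≤ 1) {M : ℝ}
    (hM : 1 < M) (hbound : ∀ w : ℂ, ‖w‖ < 1 → ∏ i, ‖1 - a i * w‖ ≤ M) (k : ℕ) :
    ‖∑ i, a i ^ (k + 1)‖ ≤ (k + 1) * 2 ^ (k + 2) * Real.log M := by
  set f : ℂ → ℂ := fun w => ∑ i, log (1 - a i * w) with hf
  have hslit : ∀ i, ∀ w : ℂ, ‖w‖ < 1 → 1 - a i * w ∈ slitPlane :=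
    fun i w hw => one_sub_mul_mem_slitPlane (ha i) hw
  have hdiff : DifferentiableOn ℂ f (Metric.ball 0 1) := by
    refine DifferentiableOn.fun_sum fun i _ => DifferentiableOn.clog (by fun_prop) fun w hw => ?_
    exact hslit i w (by simpa using hw)
  -- The real part of `f` is the logarithm of the product of the moduli, so `hbound` is a one-sided
  -- bound, as Borel–Carathéodory requires.
  have hre : Set.MapsTo f (Metric.ball 0 1) {z | z.re ≤ Real.log M} := by
    intro w hw
    have hw' : ‖w‖ < 1 := by simpa using hw
    simp only [hf, Set.mem_ofPred_eq, re_sum, log_re]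
    rw [← Real.log_prod fun i _ => norm_ne_zero_iff.2 (slitPlane_ne_zero (hslit i w hw'))]
    refine Real.log_le_log (Finset.prod_pos fun i _ => ?_) (hbound w hw')
    exact norm_pos_iff.2 (slitPlane_ne_zero (hslit i w hw'))
  have hlog : 0 < Real.log M := Real.log_pos hM
  have hsphere : ∀ z ∈ Metric.sphere (0 : ℂ) (1 / 2), ‖f z‖ ≤ 2 * Real.log M := by
    intro z hz
    have hz' : ‖z‖ = 1 / 2 := by simpa using hz
    have := borelCaratheodory_zero hlog hdiff hre one_pos
      (z := z) (by rw [mem_ball_zero_iff, hz']; norm_num) (by simp [hf])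
    rw [hz'] at this
    norm_num at this ⊢
    linarith
  -- Radius `1 / 2` gives `(k + 1)! * 2 ^ (k + 1) * (2 * log M)`. The derivative at `0` carries a
  -- factor `k !`, which leaves `(k + 1) * 2 ^ (k + 2)`.
  have hcauchy := norm_iteratedDeriv_le_of_forall_mem_sphere_norm_le (k + 1)
    (by norm_num : (0 : ℝ) < 1 / 2)
    ((hdiff.mono (by
      rw [closure_ball _ (by norm_num)]
      exact Metric.closedBall_subset_ball (by norm_num))).diffContOnCl) hsphere
  have hder : iteratedDeriv (k + 1) f 0 = -(k.factorial * ∑ i, a i ^ (k + 1)) := by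
    rw [hf, iteratedDeriv_fun_sum]
    · rw [Finset.mul_sum, ← Finset.sum_neg_distrib]
      refine Finset.sum_congr rfl fun i _ => ?_
      rw [iteratedDeriv_succ_log_one_sub_mul _ _ (hslit i 0 (by simp))]
      simp
    · intro i _
      have han : AnalyticAt ℂ (fun w => 1 - a i * w) 0 := by fun_prop
      exact (han.clog (hslit i 0 (by simp))).contDiffAt
  rw [hder, norm_neg, norm_mul, norm_natCast, Nat.factorial_succ] at hcauchy
  have hk : (0 : ℝ) < k.factorial := by exact_mod_cast k.factorial_pos
  refine le_of_mul_le_mul_left (hcauchy.trans_eq ?_) hk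
  push_cast
  rw [one_div, inv_pow, div_inv_eq_mul]
  ring

lemma norm_one_sub_conj_mul {z y : ℂ} (hy : ‖y‖ = 1) : ‖1 - conj z * y‖ = ‖y - z‖ := by
  have h : conj y * y = 1 := by
    rw [conj_mul', hy]
    simp
  have h2 : 1 - conj z * y = conj (y - z) * y := by
    rw [map_sub, sub_mul, h]
  rw [h2, norm_mul, hy, mul_one, norm_conj]

lemma norm_le_of_norm_le_sphere {f : ℂ → ℂ} (hf : Differentiable ℂ f) {M : ℝ}
    (hM : ∀ y : ℂ, ‖y‖ = 1 → ‖f y‖ ≤ M) {w : ℂ} (hw : ‖w‖ ≤ 1) : ‖f w‖ ≤ M := by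
  refine norm_le_of_forall_mem_frontier_norm_le (U := Metric.ball 0 1) Metric.isBounded_ball
    hf.diffContOnCl (fun z hz => hM z ?_) ?_
  · rw [frontier_ball _ one_ne_zero] at hz
    simpa using hz
  · rw [closure_ball _ one_ne_zero]
    simpa using hw

section Roots

variable {ι : Type*} [Fintype ι] {z : ι → ℂ} {M : ℝ}

/-- Reflecting the zeros inside the disc, the maximum principle bounds the Mahler measure. -/
lemma prod_max_norm_le (hM : ∀ y : ℂ, ‖y‖ = 1 → ∏ i, ‖y - z i‖ ≤ M) :
    ∏ i, max 1 ‖z i‖ ≤ M := by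
  classical
  -- Replacing `y - z i` by `1 - conj (z i) * y` keeps the modulus on the circle, while at `0` it
  -- turns a factor `‖z i‖ ≤ 1` into `1`.
  have h := norm_le_of_norm_le_sphere (M := M) (w := 0)
    (f := fun y => ∏ i, if ‖z i‖ ≤ 1 then 1 - conj (z i) * y else y - z i) ?_ ?_ (by simp)
  · refine le_trans (le_of_eq ?_) h
    rw [norm_prod]
    refine Finset.prod_congr rfl fun i _ => ?_
    split_ifs with hi
    · simp [hi]
    · simp [(not_le.1 hi).le]
  · refine Differentiable.fun_finsetProd fun i _ => ?_
    split_ifs <;> fun_prop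
  · intro y hy
    refine le_trans (le_of_eq ?_) (hM y hy)
    rw [norm_prod]
    refine Finset.prod_congr rfl fun i _ => ?_
    split_ifs with hi
    · exact norm_one_sub_conj_mul hy
    · rfl

/-- Since `|log r| = 2 log (max 1 r) - log r`, the Mahler measure bounds the first part, and `h0`
lets the second be dropped. -/
lemma sum_abs_log_norm_le (hz : ∀ i, z i ≠ 0) (h0 : 1 ≤ ∏ i, ‖z i‖)
    (hM : ∀ y : ℂ, ‖y‖ = 1 → ∏ i, ‖y - z i‖ ≤ M) :
    ∑ i, |Real.log ‖z i‖| ≤ 2 * Real.log M := by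
  have h1 : ∑ i, Real.log (max 1 ‖z i‖) ≤ Real.log M := by
    rw [← Real.log_prod fun i _ => (lt_max_of_lt_left one_pos).ne']
    exact Real.log_le_log (Finset.prod_pos fun i _ => lt_max_of_lt_left one_pos)
      (prod_max_norm_le hM)
  have h2 : 0 ≤ ∑ i, Real.log ‖z i‖ := by
    rw [← Real.log_prod fun i _ => norm_ne_zero_iff.2 (hz i)]
    exact Real.log_nonneg h0
  have h3 : ∀ i, |Real.log ‖z i‖| = 2 * Real.log (max 1 ‖z i‖) - Real.log ‖z i‖ := by
    intro i
    rcases le_total ‖z i‖ 1 with h | h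
    · rw [max_eq_left h, abs_of_nonpos (Real.log_nonpos (norm_nonneg _) h)]
      simp
    · rw [max_eq_right h, abs_of_nonneg (Real.log_nonneg h)]
      ring
  simp only [h3, Finset.sum_sub_distrib, ← Finset.mul_sum]
  linarith

/-- The point `z` or its mirror image in the unit circle, whichever has norm at most `1`,
conjugated. -/
noncomputable def discReflection (z : ℂ) : ℂ :=
  if ‖z‖ ≤ 1 then conj z else z⁻¹

lemma norm_discReflection_le (z : ℂ) : ‖discReflection z‖ ≤ 1 := by
  rw [discReflection]
  split_ifs with h
  · simpa using h
  · rw [norm_inv]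
    exact inv_le_one_of_one_le₀ (not_le.1 h).le

lemma norm_one_sub_discReflection_mul_le {z y : ℂ} (hy : ‖y‖ = 1) :
    ‖1 - discReflection z * y‖ ≤ ‖y - z‖ := by
  rw [discReflection]
  split_ifs with h
  · exact (norm_one_sub_conj_mul hy).le
  · have hz : z ≠ 0 := by
      rintro rfl
      simp at h
    have h2 : 1 - z⁻¹ * y = z⁻¹ * (z - y) := by
      field_simp
    rw [h2, norm_mul, norm_inv, norm_sub_rev]
    exact mul_le_of_le_one_left (norm_nonneg _) (inv_le_one_of_one_le₀ (not_le.1 h).le)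

lemma discReflection_eq {z : ℂ} (hz : z ≠ 0) :
    discReflection z = conj (z / ‖z‖) * (Real.exp (-|Real.log ‖z‖|) : ℝ) := by
  have hpos : 0 < ‖z‖ := norm_pos_iff.2 hz
  have hne : (‖z‖ : ℂ) ≠ 0 := ofReal_ne_zero.2 hpos.ne'
  rw [discReflection, map_div₀, conj_ofReal]
  split_ifs with h
  · rw [abs_of_nonpos (Real.log_nonpos hpos.le h), neg_neg, Real.exp_log hpos]
    field_simp
  · rw [abs_of_nonneg (Real.log_nonneg (not_le.1 h).le), Real.exp_neg, Real.exp_log hpos, inv_def,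
      normSq_eq_norm_sq]
    push_cast
    field_simp

/-- Both numbers have the same argument, so only the moduli `1` and `exp (-k * |log ‖z‖|)` differ.
-/
lemma norm_conj_pow_sub_discReflection_pow_le {z : ℂ} (hz : z ≠ 0) (k : ℕ) :
    ‖conj (z / ‖z‖) ^ k - discReflection z ^ k‖ ≤ k * |Real.log ‖z‖| := by
  have hb : ‖conj (z / ‖z‖)‖ = 1 := by
    rw [norm_conj, norm_div, norm_real, norm_norm, div_self (norm_ne_zero_iff.2 hz)]
  rw [discReflection_eq hz, mul_pow, ← mul_one_sub, norm_mul, norm_pow, hb, one_pow, one_mul,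
    ← ofReal_pow, ← Real.exp_nat_mul, ← ofReal_one, ← ofReal_sub, norm_real, Real.norm_eq_abs]
  have h1 : Real.exp (k * -|Real.log ‖z‖|) ≤ 1 := by
    rw [Real.exp_le_one_iff, mul_neg]
    exact neg_nonpos.2 (by positivity)
  have h2 := Real.add_one_le_exp (k * -|Real.log ‖z‖|)
  rw [abs_of_nonneg (sub_nonneg.2 h1)]
  linarith

/-- The power sums of the arguments of the zeros of a monic polynomial are bounded by the
logarithm of its maximum on the unit circle. -/
lemma norm_sum_direction_pow_le (hz : ∀ i, z i ≠ 0) (h0 : 1 ≤ ∏ i, ‖z i‖) (hM1 : 1 < M)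
    (hM : ∀ y : ℂ, ‖y‖ = 1 → ∏ i, ‖y - z i‖ ≤ M) (k : ℕ) :
    ‖∑ i, (z i / ‖z i‖) ^ (k + 1)‖ ≤ (k + 1) * (2 ^ (k + 2) + 2) * Real.log M := by
  have h1 := norm_sum_pow_le (a := fun i => discReflection (z i))
    (fun i => norm_discReflection_le (z i)) hM1 ?_ k
  -- The price of passing from reflected zeros to directions; it accounts for the `+ 2` in the
  -- constant.
  · have h2 : ‖∑ i, (conj (z i / ‖z i‖) ^ (k + 1) - discReflection (z i) ^ (k + 1))‖ ≤
        (k + 1) * (2 * Real.log M) := by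
      refine (norm_sum_le_of_le _
        fun i _ => norm_conj_pow_sub_discReflection_pow_le (hz i) (k + 1)).trans ?_
      rw [← Finset.mul_sum]
      push_cast
      gcongr
      exact sum_abs_log_norm_le hz h0 hM
    rw [Finset.sum_sub_distrib] at h2
    have h3 : ‖∑ i, (z i / ‖z i‖) ^ (k + 1)‖ = ‖∑ i, conj (z i / ‖z i‖) ^ (k + 1)‖ := by
      rw [← norm_conj, map_sum]
      simp only [map_pow]
    rw [h3]
    have h4 := norm_le_norm_sub_add (∑ i, conj (z i / ‖z i‖) ^ (k + 1))
      (∑ i, discReflection (z i) ^ (k + 1))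
    linarith
  · intro w hw
    rw [← norm_prod]
    refine norm_le_of_norm_le_sphere (f := fun w => ∏ i, (1 - discReflection (z i) * w))
      (Differentiable.fun_finsetProd fun i _ => by fun_prop) (fun y hy => ?_) hw.le
    rw [norm_prod]
    exact (Finset.prod_le_prod (fun _ _ => norm_nonneg _)
      fun i _ => norm_one_sub_discReflection_mul_le hy).trans (hM y hy)

end Roots

end Complex

/-! ### Weyl's criterion on the circle -/

section Mean

/-- The average of a function over a finite type. -/
noncomputable def finiteMean {ι : Type*} [Fintype ι] (u : ι → ℂ) : ℂ :=
  (Fintype.card ι : ℂ)⁻¹ * ∑ i, u i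

lemma finiteMean_sub {ι : Type*} [Fintype ι] (u v : ι → ℂ) :
    finiteMean (fun i => u i - v i) = finiteMean u - finiteMean v := by
  simp only [finiteMean, Finset.sum_sub_distrib, mul_sub]

lemma norm_finiteMean_le {ι : Type*} [Fintype ι] (u : ι → ℂ) :
    ‖finiteMean u‖ ≤ (Fintype.card ι : ℝ)⁻¹ * ∑ i, ‖u i‖ := by
  rw [finiteMean, norm_mul, norm_inv, Complex.norm_natCast]
  gcongr
  exact norm_sum_le _ _

lemma inv_card_mul_card_le {ι : Type*} [Fintype ι] {C : ℝ} (hC : 0 ≤ C) :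
    (Fintype.card ι : ℝ)⁻¹ * (Fintype.card ι * C) ≤ C := by
  rcases eq_or_ne (Fintype.card ι : ℝ) 0 with h | h
  · simpa [h]
  · rw [inv_mul_cancel_left₀ h]

lemma norm_finiteMean_le_of_forall_le {ι : Type*} [Fintype ι] {u : ι → ℂ} {C : ℝ} (hC : 0 ≤ C)
    (h : ∀ i, ‖u i‖ ≤ C) : ‖finiteMean u‖ ≤ C := by
  refine (norm_finiteMean_le u).trans (le_trans ?_ (inv_card_mul_card_le (ι := ι) hC))
  gcongr
  refine (Finset.sum_le_sum fun i _ => h i).trans_eq ?_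
  rw [Finset.sum_const, nsmul_eq_mul, Finset.card_univ]

variable {T : ℝ} [hT : Fact (0 < T)] {ι : ℕ → Type*} [∀ n, Fintype (ι n)]

lemma integral_fourier_of_ne_zero {k : ℤ} (hk : k ≠ 0) :
    ∫ x : AddCircle T, fourier k x ∂AddCircle.haarAddCircle = 0 := by
  have h := congrFun (fourierCoeff_fourier (T := T) k) 0
  rw [Pi.single_eq_of_ne hk.symm] at h
  simpa [fourierCoeff] using h

lemma norm_integral_haarAddCircle_le (g : C(AddCircle T, ℂ)) :
    ‖∫ x, g x ∂AddCircle.haarAddCircle (T := T)‖ ≤ ‖g‖ := by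
  have := norm_integral_le_of_norm_le_const (μ := AddCircle.haarAddCircle (T := T))
    (Eventually.of_forall fun x => g.norm_coe_le_norm x)
  simpa using this

/-- **Weyl's criterion** for a sequence of finite families of points of the circle. -/
lemma tendsto_finiteMean_of_forall_fourier (x : ∀ n, ι n → AddCircle T)
    (hne : ∀ᶠ n in atTop, Nonempty (ι n))
    (h : ∀ k : ℕ, Tendsto (fun n => finiteMean fun i => fourier (k + 1 : ℤ) (x n i)) atTop (𝓝 0))
    (g : C(AddCircle T, ℂ)) :
    Tendsto (fun n => finiteMean fun i => g (x n i)) atTop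
      (𝓝 (∫ y, g y ∂AddCircle.haarAddCircle)) := by
  have hfourier : ∀ k : ℤ, Tendsto (fun n => finiteMean fun i => fourier k (x n i)) atTop
      (𝓝 (∫ y : AddCircle T, fourier k y ∂AddCircle.haarAddCircle)) := by
    intro k
    rcases lt_trichotomy k 0 with hk | rfl | hk
    · rw [integral_fourier_of_ne_zero hk.ne]
      obtain ⟨m, hm⟩ := Int.eq_ofNat_of_zero_le (show 0 ≤ -k - 1 by omega)
      -- Negative frequencies are the conjugates of positive ones.
      have hk' : k = -(m + 1 : ℤ) := by omega
      have := (Complex.continuous_conj.tendsto 0).comp (h m)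
      rw [map_zero] at this
      refine this.congr fun n => ?_
      simp only [Function.comp_apply, finiteMean, map_mul, map_inv₀, map_natCast, map_sum, hk',
        fourier_neg]
    · refine tendsto_const_nhds.congr' ?_
      filter_upwards [hne] with n hn
      simp [finiteMean]
    · rw [integral_fourier_of_ne_zero hk.ne']
      obtain ⟨m, hm⟩ := Int.eq_ofNat_of_zero_le (show 0 ≤ k - 1 by omega)
      rw [show k = m + 1 by omega]
      exact h m
  have hspan : ∀ g ∈ Submodule.span ℂ (Set.range (fourier (T := T))),
      Tendsto (fun n => finiteMean fun i => g (x n i)) atTop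
        (𝓝 (∫ y, g y ∂AddCircle.haarAddCircle)) := by
    intro g hg
    induction hg using Submodule.span_induction with
    | mem g hg =>
      obtain ⟨k, rfl⟩ := hg
      exact hfourier k
    | zero => simp [finiteMean]
    | add g₁ g₂ _ _ h₁ h₂ =>
      have hint : ∀ g : C(AddCircle T, ℂ), Integrable g AddCircle.haarAddCircle := fun g =>
        g.continuous.integrable_of_hasCompactSupport (HasCompactSupport.of_compactSpace _)
      simp only [ContinuousMap.add_apply]
      rw [integral_add (hint g₁) (hint g₂)]
      refine (h₁.add h₂).congr fun n => ?_
      simp only [finiteMean, Finset.sum_add_distrib, mul_add]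
    | smul c g _ h₁ =>
      simp only [ContinuousMap.smul_apply, smul_eq_mul]
      rw [integral_const_mul]
      refine (h₁.const_mul c).congr fun n => ?_
      simp only [finiteMean, ← Finset.mul_sum]
      ring
  rw [Metric.tendsto_nhds]
  intro ε hε
  -- Trigonometric polynomials are uniformly dense, and both the means and the integral are
  -- contractions for the sup norm.
  have hg : g ∈ closure (Submodule.span ℂ (Set.range (fourier (T := T))) : Set _) := by
    rw [← Submodule.topologicalClosure_coe, span_fourier_closure_eq_top]
    trivial
  obtain ⟨g', hg', hdist⟩ := Metric.mem_closure_iff.1 hg (ε / 3) (by positivity)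
  rw [dist_eq_norm] at hdist
  have hint : ∀ g : C(AddCircle T, ℂ), Integrable g AddCircle.haarAddCircle := fun g =>
    g.continuous.integrable_of_hasCompactSupport (HasCompactSupport.of_compactSpace _)
  have h2 : ‖∫ y, g y ∂AddCircle.haarAddCircle - ∫ y, g' y ∂AddCircle.haarAddCircle‖ < ε / 3 := by
    rw [← integral_sub (hint g) (hint g')]
    exact (norm_integral_haarAddCircle_le (g - g')).trans_lt hdist
  filter_upwards [Metric.tendsto_nhds.1 (hspan g' hg') (ε / 3) (by positivity)] with n hn
  have h1 : ‖(finiteMean fun i => g (x n i)) - finiteMean fun i => g' (x n i)‖ < ε / 3 := by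
    rw [← finiteMean_sub]
    exact (norm_finiteMean_le_of_forall_le (norm_nonneg _)
      fun i => (g - g').norm_coe_le_norm (x n i)).trans_lt hdist
  rw [dist_eq_norm] at hn ⊢
  calc _ = ‖((finiteMean fun i => g (x n i)) - finiteMean fun i => g' (x n i)) +
        ((finiteMean fun i => g' (x n i)) - ∫ y, g' y ∂AddCircle.haarAddCircle) -
        (∫ y, g y ∂AddCircle.haarAddCircle - ∫ y, g' y ∂AddCircle.haarAddCircle)‖ := by
        congr 1
        ring
    _ < ε := by
        refine (norm_sub_le _ _).trans_lt ?_
        linarith [norm_add_le ((finiteMean fun i => g (x n i)) - finiteMean fun i => g' (x n i))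
          ((finiteMean fun i => g' (x n i)) - ∫ y, g' y ∂AddCircle.haarAddCircle)]

end Mean

/-! ### From directions on the circle to points of the plane -/

section Circle

open BoundedContinuousFunction

lemma norm_direction {z : ℂ} (hz : z ≠ 0) : ‖z / ‖z‖‖ = 1 := by
  rw [norm_div, Complex.norm_real, norm_norm, div_self (norm_ne_zero_iff.2 hz)]

lemma norm_sub_direction {z : ℂ} (hz : z ≠ 0) :
    ‖z - z / ‖z‖‖ = |Real.exp (Real.log ‖z‖) - 1| := by
  have hne : (‖z‖ : ℂ) ≠ 0 := Complex.ofReal_ne_zero.2 (norm_ne_zero_iff.2 hz)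
  have h : z - z / ‖z‖ = z / ‖z‖ * ((‖z‖ - 1 : ℝ) : ℂ) := by
    push_cast
    field_simp
  rw [h, norm_mul, norm_direction hz, one_mul, Complex.norm_real, Real.norm_eq_abs,
    Real.exp_log (norm_pos_iff.2 hz)]

/-- Near the circle, continuity of `f` on a compact set gives `ε`. Away from it `|log ‖z‖|` is
bounded below, so a large `K` absorbs the trivial bound `2 * ‖f‖`. -/
lemma exists_norm_sub_direction_le (f : ℂ →ᵇ ℂ) {ε : ℝ} (hε : 0 < ε) :
    ∃ K : ℝ, 0 ≤ K ∧ ∀ z : ℂ, z ≠ 0 → ‖f z - f (z / ‖z‖)‖ ≤ ε + K * |Real.log ‖z‖| := by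
  obtain ⟨δ, hδ, hfδ⟩ := Metric.mem_uniformity_dist.1
    ((isCompact_sphere (0 : ℂ) 1).uniformContinuousAt_of_continuousAt f
      (fun a _ => f.continuous.continuousAt) (Metric.dist_mem_uniformity hε))
  have hcont : ContinuousAt (fun s : ℝ => |Real.exp s - 1|) 0 := by fun_prop
  obtain ⟨η, hη, hexp⟩ := Metric.eventually_nhds_iff.1
    (hcont.eventually_lt continuousAt_const (by simpa using hδ))
  refine ⟨2 * ‖f‖ / η, by positivity, fun z hz => ?_⟩
  by_cases hsmall : |Real.log ‖z‖| < η
  · have h1 := hexp (y := Real.log ‖z‖) (by simpa using hsmall)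
    rw [← norm_sub_direction hz, ← dist_eq_norm, dist_comm] at h1
    have h2 := hfδ h1 (by simpa using norm_direction hz)
    have h3 : dist (f (z / ‖z‖)) (f z) < ε := h2
    rw [dist_comm, dist_eq_norm] at h3
    have : 0 ≤ 2 * ‖f‖ / η * |Real.log ‖z‖| := by positivity
    linarith
  · have h1 : ‖f z - f (z / ‖z‖)‖ ≤ 2 * ‖f‖ := by
      refine (norm_sub_le _ _).trans ?_
      linarith [f.norm_coe_le_norm z, f.norm_coe_le_norm (z / ‖z‖)]
    have h2 : 2 * ‖f‖ ≤ 2 * ‖f‖ / η * |Real.log ‖z‖| := by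
      rw [div_mul_eq_mul_div, le_div_iff₀ hη]
      gcongr
      exact not_lt.1 hsmall
    linarith

lemma direction_eq_exp_arg {z : ℂ} (hz : z ≠ 0) :
    z / ‖z‖ = Complex.exp (z.arg * Complex.I) := by
  have hne : (‖z‖ : ℂ) ≠ 0 := Complex.ofReal_ne_zero.2 (norm_ne_zero_iff.2 hz)
  rw [div_eq_iff hne, mul_comm, Complex.norm_mul_exp_arg_mul_I]

lemma integral_uniformUnitCircle (f : ℂ →ᵇ ℂ) :
    ∫ z, f z ∂(uniformUnitCircle.toFiniteMeasure : Measure ℂ) =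
      (2 * Real.pi)⁻¹ • ∫ θ in Set.Ioc 0 (2 * Real.pi), f (Complex.exp (θ * Complex.I)) := by
  have hm : Measurable fun θ : ℝ => Complex.exp (θ * Complex.I) := by fun_prop
  change ∫ z, f z ∂((ENNReal.ofReal (2 * Real.pi))⁻¹ •
    (volume.restrict (Set.Ioc 0 (2 * Real.pi))).map (fun θ : ℝ => Complex.exp (θ * Complex.I))) = _
  rw [integral_smul_measure, integral_map hm.aemeasurable
    f.continuous.aestronglyMeasurable, ENNReal.toReal_inv,
    ENNReal.toReal_ofReal (by positivity)]

/-- Finite families of nonzero complex numbers equidistribute on the unit circle if their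
logarithmic distances to it and the power sums of their directions are small on average. -/
lemma tendsto_finiteMean_uniformUnitCircle {ι : ℕ → Type*} [∀ n, Fintype (ι n)]
    {z : ∀ n, ι n → ℂ} (hne : ∀ᶠ n in atTop, Nonempty (ι n))
    (hz : ∀ᶠ n in atTop, ∀ i, z n i ≠ 0)
    (hlog : Tendsto (fun n => (Fintype.card (ι n) : ℝ)⁻¹ * ∑ i, |Real.log ‖z n i‖|) atTop (𝓝 0))
    (hpow : ∀ k : ℕ, Tendsto (fun n => finiteMean fun i => (z n i / ‖z n i‖) ^ (k + 1)) atTop (𝓝 0))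
    (f : ℂ →ᵇ ℂ) :
    Tendsto (fun n => finiteMean fun i => f (z n i)) atTop
      (𝓝 (∫ w, f w ∂(uniformUnitCircle.toFiniteMeasure : Measure ℂ))) := by
  have hT : Fact (0 < 2 * Real.pi) := ⟨Real.two_pi_pos⟩
  let g : C(AddCircle (2 * Real.pi), ℂ) :=
    ⟨fun x => f (AddCircle.toCircle x), f.continuous.comp
      (continuous_subtype_val.comp AddCircle.continuous_toCircle)⟩
  have hg : ∀ θ : ℝ, g (θ : AddCircle (2 * Real.pi)) = f (Complex.exp (θ * Complex.I)) := by
    intro θ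
    simp only [g, ContinuousMap.coe_mk, AddCircle.toCircle_apply_mk, Circle.coe_exp]
    rw [div_self Real.two_pi_pos.ne', one_mul]
  have hintegral : ∫ w, f w ∂(uniformUnitCircle.toFiniteMeasure : Measure ℂ) =
      ∫ y, g y ∂AddCircle.haarAddCircle := by
    rw [integral_uniformUnitCircle, AddCircle.integral_haarAddCircle,
      ← AddCircle.integral_preimage (2 * Real.pi) 0, zero_add]
    simp only [hg]
  have hdir : Tendsto (fun n => finiteMean fun i => g ((z n i).arg : AddCircle (2 * Real.pi))) atTop
      (𝓝 (∫ y, g y ∂AddCircle.haarAddCircle)) := by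
    refine tendsto_finiteMean_of_forall_fourier _ hne (fun k => ?_) g
    refine (hpow k).congr' ?_
    filter_upwards [hz] with n hn
    congr 1
    ext i
    rw [direction_eq_exp_arg (hn i), ← Complex.exp_nat_mul, fourier_coe_apply]
    congr 1
    have : (Real.pi : ℂ) ≠ 0 := Complex.ofReal_ne_zero.2 Real.pi_ne_zero
    push_cast
    field_simp
  rw [hintegral]
  -- Moving every point radially to the circle changes the mean negligibly, by `hlog`.
  have hdiff : Tendsto (fun n => (finiteMean fun i => f (z n i)) -
      finiteMean fun i => g ((z n i).arg : AddCircle (2 * Real.pi))) atTop (𝓝 0) := by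
    rw [Metric.tendsto_nhds]
    intro ε hε
    obtain ⟨K, hK, hfK⟩ := exists_norm_sub_direction_le f (half_pos hε)
    have hKlog := hlog.const_mul K
    rw [mul_zero] at hKlog
    filter_upwards [hz, hKlog.eventually_lt_const (half_pos hε)] with n hn hlt
    rw [dist_zero_right, ← finiteMean_sub]
    refine (norm_finiteMean_le _).trans_lt ?_
    calc (Fintype.card (ι n) : ℝ)⁻¹ *
          ∑ i, ‖f (z n i) - g ((z n i).arg : AddCircle (2 * Real.pi))‖
        ≤ (Fintype.card (ι n) : ℝ)⁻¹ * ∑ i, (ε / 2 + K * |Real.log ‖z n i‖|) := by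
          gcongr with i
          rw [hg, ← direction_eq_exp_arg (hn i)]
          exact hfK _ (hn i)
      _ = (Fintype.card (ι n) : ℝ)⁻¹ * (Fintype.card (ι n) * (ε / 2)) +
          K * ((Fintype.card (ι n) : ℝ)⁻¹ * ∑ i, |Real.log ‖z n i‖|) := by
          rw [Finset.sum_add_distrib, Finset.sum_const, Finset.card_univ, nsmul_eq_mul,
            ← Finset.mul_sum]
          ring
      _ < ε := by linarith [inv_card_mul_card_le (ι := ι n) (half_pos hε).le]
  simpa using hdiff.add hdir

end Circle

/-! ### Empirical measures as means over the roots -/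

section Roots

open BoundedContinuousFunction

lemma mass_sum_diracProba (s : Multiset ℂ) :
    ((s.map fun z => (diracProba z).toFiniteMeasure).sum : FiniteMeasure ℂ).toMeasure Set.univ =
      s.card := by
  induction s using Multiset.induction_on with
  | empty => simp
  | cons a s ih =>
    rw [Multiset.map_cons, Multiset.sum_cons, FiniteMeasure.toMeasure_add, Measure.add_apply, ih]
    simp [add_comm]

lemma integral_sum_diracProba (s : Multiset ℂ) (f : ℂ →ᵇ ℂ) :
    ∫ z, f z ∂((s.map fun z => (diracProba z).toFiniteMeasure).sum : FiniteMeasure ℂ).toMeasure =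
      (s.map f).sum := by
  induction s using Multiset.induction_on with
  | empty => simp
  | cons a s ih =>
    rw [Multiset.map_cons, Multiset.sum_cons, FiniteMeasure.toMeasure_add,
      integral_add_measure (f.integrable _) (f.integrable _), ih, Multiset.map_cons,
      Multiset.sum_cons]
    congr 1
    exact integral_dirac _ _

lemma natDegree_eq_card_roots_complex (p : ℂ[X]) : p.natDegree = p.roots.card :=
  (IsAlgClosed.splits p).natDegree_eq_card_roots

lemma isProbabilityMeasure_empiricalMeasure {p : ℂ[X]} (hp : p.natDegree ≠ 0) :
    IsProbabilityMeasure (empiricalMeasure p : Measure ℂ) := by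
  constructor
  rw [empiricalMeasure, FiniteMeasure.toMeasure_smul, Measure.smul_apply, mass_sum_diracProba,
    ← natDegree_eq_card_roots_complex, ENNReal.smul_def, smul_eq_mul,
    ENNReal.coe_inv (Nat.cast_ne_zero.2 hp), ENNReal.coe_natCast]
  exact ENNReal.inv_mul_cancel (Nat.cast_ne_zero.2 hp) (ENNReal.natCast_ne_top _)

-- The multiset `p.roots`, coerced to a type, has one element per root counted with multiplicity, so
-- the integral is a plain mean.
open scoped Classical in
lemma integral_empiricalMeasure (p : ℂ[X]) (f : ℂ →ᵇ ℂ) :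
    ∫ z, f z ∂(empiricalMeasure p : Measure ℂ) = finiteMean fun i : p.roots => f i.1 := by
  have h : ∑ i : p.roots, f i.1 = (p.roots.map f).sum := by
    rw [← Multiset.map_univ]
    rfl
  rw [empiricalMeasure, FiniteMeasure.toMeasure_smul, integral_smul_nnreal_measure,
    integral_sum_diracProba, finiteMean, h, Multiset.card_coe, ← natDegree_eq_card_roots_complex,
    NNReal.smul_def, Complex.real_smul]
  simp

open scoped Classical in
lemma norm_eval_eq_prod_of_monic {p : ℂ[X]} (hp : p.Monic) (y : ℂ) :
    ‖p.eval y‖ = ∏ i : p.roots, ‖y - i.1‖ := by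
  rw [(IsAlgClosed.splits p).eval_eq_prod_roots_of_monic hp, ← norm_prod]
  congr 1
  rw [← Multiset.map_univ]
  rfl

/-- If `p n` is monic, not small at `0`, and not large on the unit circle on the scale of its
degree, then the zeros of `p n` are equidistributed on the unit circle. -/
lemma tendsto_empiricalMeasure_uniformUnitCircle {p : ℕ → ℂ[X]} {M : ℕ → ℝ}
    (hp : ∀ᶠ n in atTop, (p n).Monic) (hdeg : ∀ᶠ n in atTop, (p n).natDegree ≠ 0)
    (h0 : ∀ᶠ n in atTop, 1 ≤ ‖(p n).eval 0‖) (hM1 : ∀ᶠ n in atTop, 1 < M n)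
    (hM : ∀ᶠ n in atTop, ∀ y : ℂ, ‖y‖ = 1 → ‖(p n).eval y‖ ≤ M n)
    (hlim : Tendsto (fun n => ((p n).natDegree : ℝ)⁻¹ * Real.log (M n)) atTop (𝓝 0)) :
    Tendsto (fun n => empiricalMeasure (p n)) atTop (𝓝 uniformUnitCircle.toFiniteMeasure) := by
  classical
  rw [FiniteMeasure.tendsto_iff_forall_integral_rclike_tendsto ℂ]
  intro f
  simp only [integral_empiricalMeasure]
  have hcard : ∀ n, (Fintype.card (p n).roots : ℝ) = (p n).natDegree := fun n => by
    rw [Multiset.card_coe, natDegree_eq_card_roots_complex]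
  have hz : ∀ᶠ n in atTop, ∀ i : (p n).roots, i.1 ≠ 0 := by
    filter_upwards [h0] with n hn i hi
    have hroot := (mem_roots'.1 (Multiset.coe_mem (x := i))).2
    rw [hi, IsRoot.def] at hroot
    rw [hroot, norm_zero] at hn
    exact absurd hn (by norm_num)
  have hprod0 : ∀ᶠ n in atTop, 1 ≤ ∏ i : (p n).roots, ‖i.1‖ := by
    filter_upwards [hp, h0] with n hn h
    rw [norm_eval_eq_prod_of_monic hn] at h
    simpa using h
  have hprodM : ∀ᶠ n in atTop, ∀ y : ℂ, ‖y‖ = 1 → ∏ i : (p n).roots, ‖y - i.1‖ ≤ M n := by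
    filter_upwards [hp, hM] with n hn h y hy
    rw [← norm_eval_eq_prod_of_monic hn]
    exact h y hy
  refine tendsto_finiteMean_uniformUnitCircle (z := fun n (i : (p n).roots) => i.1) ?_ hz ?_
    (fun k => ?_) f
  · filter_upwards [hdeg] with n hn
    refine Fintype.card_pos_iff.1 ?_
    rw [Multiset.card_coe, ← natDegree_eq_card_roots_complex]
    exact Nat.pos_of_ne_zero hn
  · have hlim' := hlim.const_mul 2
    rw [mul_zero] at hlim'
    refine squeeze_zero' (Eventually.of_forall fun n => by positivity) ?_ hlim'
    filter_upwards [hz, hprod0, hprodM] with n h1 h2 h3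
    rw [hcard, mul_left_comm]
    gcongr
    exact Complex.sum_abs_log_norm_le h1 h2 h3
  · have hlim' := hlim.const_mul (((k : ℝ) + 1) * (2 ^ (k + 2) + 2))
    rw [mul_zero] at hlim'
    refine squeeze_zero_norm' ?_ hlim'
    filter_upwards [hz, hprod0, hprodM, hM1] with n h1 h2 h3 h4
    rw [finiteMean, norm_mul, norm_inv, Complex.norm_natCast, hcard, mul_left_comm]
    gcongr
    exact Complex.norm_sum_direction_pow_le h1 h2 h4 h3 k

end Roots

/-! ### Conclusion for connected graphs -/

lemma natDegree_connectedGraphPoly_ne_zero {n : ℕ} (hn : 2 ≤ n) :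
    (connectedGraphPoly n).natDegree ≠ 0 := by
  rw [natDegree_connectedGraphPoly (by omega)]
  have := le_mul_pred_div_two (n := n) (by omega)
  omega

lemma tendsto_log_pow_div_natDegree :
    Tendsto (fun n : ℕ => ((connectedGraphPoly n).natDegree : ℝ)⁻¹ * Real.log ((n : ℝ) ^ n))
      atTop (𝓝 0) := by
  have h1 : Tendsto (fun n : ℕ => Real.log n / n) atTop (𝓝 0) :=
    Real.isLittleO_log_id_atTop.tendsto_div_nhds_zero.comp tendsto_natCast_atTop_atTop
  have h2 := h1.const_mul 4
  rw [mul_zero] at h2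
  refine squeeze_zero' (Eventually.of_forall fun n => ?_) ?_ h2
  · rw [Real.log_pow]
    exact mul_nonneg (by positivity) (mul_nonneg (by positivity) (Real.log_natCast_nonneg n))
  · filter_upwards [eventually_ge_atTop 2] with n hn
    have hn2 : (2 : ℝ) ≤ n := by exact_mod_cast hn
    have hd : ((connectedGraphPoly n).natDegree : ℝ) = n * (n - 1) / 2 := by
      rw [natDegree_connectedGraphPoly (by omega), ← Nat.choose_two_right, Nat.cast_choose_two]
    have hlog : 0 ≤ Real.log n := Real.log_natCast_nonneg n
    rw [hd, Real.log_pow, inv_mul_eq_div, mul_div_assoc', div_le_div_iff₀ (by nlinarith)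
      (by linarith)]
    -- For `n ≥ 2`, `n - 1 ≥ n / 2`; hence the constant `4` in the comparison with `log n / n`.
    have h3 : (n : ℝ) * n ≤ 2 * (n * (n - 1)) := by nlinarith
    nlinarith [mul_le_mul_of_nonneg_left h3 hlog]

theorem mainTheorem5 :
    (∀ n : ℕ, 2 ≤ n →
      (connectedGraphPoly n).Monic ∧
      (connectedGraphPoly n).natDegree = n * (n - 1) / 2 ∧
      IsProbabilityMeasure (empiricalMeasure (connectedGraphPoly n) : Measure ℂ)) ∧
    Tendsto (fun n : ℕ => empiricalMeasure (connectedGraphPoly n)) atTop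
      (𝓝 uniformUnitCircle.toFiniteMeasure) := by
  refine ⟨fun n hn => ⟨connectedGraphPoly_monic (by omega),
    natDegree_connectedGraphPoly (by omega),
    isProbabilityMeasure_empiricalMeasure (natDegree_connectedGraphPoly_ne_zero hn)⟩, ?_⟩
  have h2 := eventually_ge_atTop 2
  refine tendsto_empiricalMeasure_uniformUnitCircle (M := fun n => (n : ℝ) ^ n)
    (h2.mono fun n hn => connectedGraphPoly_monic (by omega))
    (h2.mono fun n hn => natDegree_connectedGraphPoly_ne_zero hn)
    (h2.mono fun n hn => one_le_norm_eval_zero_connectedGraphPoly (by omega))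
    (h2.mono fun n hn => one_lt_pow₀ (by exact_mod_cast hn) (by omega))
    (h2.mono fun n hn y hy => norm_eval_connectedGraphPoly_le (by omega) hy.le)
    tendsto_log_pow_div_natDegree
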